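/- **Notation.** For an odd prime $p$ write $\frac{p+1}{8}=\frac mn$ with $(m,n)=1$, $n\in\{1,2,4\}$. Let $q=e^{\pi i\tau}$, $\lambda=\theta_2^4/\theta_3^4$ with $\theta_2(\tau)=\sum_{k\in\mathbb Z}q^{(k+1/2)^2}$ and $\theta_3(\tau)=\sum_{k\in\mathbb Z}q^{k^2}$, and $$X=(\lambda(\tau)\lambda(p\tau))^{n/8},\qquad Y=\big((1-\lambda(\tau))(1-\lambda(p\tau))\big)^{n/8},$$ the holomorphic branches on the upper half-plane with $X/q^m\to 2^n$ and $Y\to1$ as $\operatorname{Im}\tau\to\infty$. Let $A_p=(a_{i,h})_{0\le i,h\le m}$ be the integer matrix of the Russell-type modular equation: $a_{0,0}=1$, $a_{i,h}=0$ for $i+h>m$, and $\sum_{i,h}a_{i,h}X^iY^h=0$ on the upper half-plane. Put $$\alpha_p(k)=s(k)-3s(\tfrac k2)+2s(\tfrac k4)+s(\tfrac kp)-3s(\tfrac k{2p})+2s(\tfrac k{4p}),$$ where $s(x)=\sigma_1(x)/x$ if $x$ is a positive integer and $s(x)=0$ otherwise. Define $$b_l(u,v)=\sum_{J}(-n)^{|J|}u^{J_o}v^{J_e}\prod_{k\ge1}\frac{\alpha_p(k)^{j_k}}{j_k!},$$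 the sum being over partitions $J$ of $l$ in which $k$ occurs $j_k$ times, where $|J|$, $J_o$, $J_e$ are the numbers of parts, odd parts and even parts (so $b_0=1$). Define $P_k(m)$ by $\sum_{h=0}^m(-1)^{h-1}\binom mh h^{m+k}=(-1)^{m-1}P_k(m)\,(m+k)!$ for $k\ge 0$. Let $a_0=(a_{0,0},\dots,a_{0,m})$ and $A^{1,0}=[\,b_{l+m}(2h,0)\,]_{0\le l\le m-1,\;0\le h\le m}$. **Theorem.** Let $(p,n)$ be $(5,4)$, $(11,2)$ or $(23,1)$; in all three cases $m=3$. *Part 1.* $$\begin{aligned} a_{1,0}&=-2^{m-n-3}n^{m-2}\Big(2n\alpha_p(2)+2m\alpha_p(3)+n^2(15-16P_1(m)+8P_2(m))\Big),\\ a_{1,1}&=-2^{m-n-3}n^{m-2}\Big(-4n\alpha_p(2)-4m\alpha_p(3)-2n^2(5-12P_1(m)+8P_2(m))\Big),\\ a_{1,2}&=-2^{m-n-3}n^{m-2}\Big(2n\alpha_p(2)+2m\alpha_p(3)+n^2(3-8P_1(m)+8P_2(m))\Big). \end{aligned}$$ *Part 2.* $$\begin{aligned} a_{2,0}=\frac1{2n}\bigg[&\tfrac13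 n^m2^{m-2n-3}\Big((464P_2(m)-384P_1(m)+135)n^4-4(24P_2(m)-29)n^3\alpha_p(2)\\ &\quad+n^2\big(-12\alpha_p(2)^2+4(48P_2(m)+29m)\alpha_p(3)\big)\\ &\quad+n\big(-24(m-2)\alpha_p(6)-24\alpha_p(4)\big)+48m\,\alpha_p(3)^2\Big)\\ &-2^{2m-2n+1}n^{2m+1}P_4(m)-n^{2m-1}2^{2m-2n-1}P_2(m)(2m-1)\alpha_p(3)\\ &-n^{2m-3}2^{2m-2n-3}\Big((2m-3)(2m-4)\tfrac{\alpha_p(3)^2}{2!}+(2m-3)\alpha_p(5)\Big)\bigg], \end{aligned}$$ and $a_{2,1}=-a_{2,0}$. *Part 3.* $$\begin{vmatrix} b_0(3,1)&b_0(5,1)&(A^{1,0}a_0)_0\\ b_1(3,1)&b_1(5,1)&(A^{1,0}a_0)_1\\ b_2(3,1)&b_2(5,1)&(A^{1,0}a_0)_2 \end{vmatrix}=m(-2n)^3\,2^n .$$ -/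

import Mathlib

open scoped BigOperators

noncomputable section

namespace Russell

/-! ### Arithmetic ingredients -/

/-- `σ₁(k/d) / (k/d)`, read as `0` when `k/d` is not an integer. -/
def sigmaQuot (k d : ℕ) : ℚ :=
  if d ∣ k then (ArithmeticFunction.sigma 1 (k / d) : ℚ) / ((k / d : ℕ) : ℚ) else 0

/-- The function `α_p(k)`. -/
def alpha (p k : ℕ) : ℚ :=
  sigmaQuot k 1 - 3 * sigmaQuot k 2 + 2 * sigmaQuot k 4
    + sigmaQuot k p - 3 * sigmaQuot k (2 * p) + 2 * sigmaQuot k (4 * p)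

/-- The weight `W_p(J) = ∏ₖ α_p(k)^{jₖ} / jₖ!` of a partition `J` in which the part `k`
occurs `jₖ` times (the factors with `jₖ = 0` are `1`). -/
def weight (p : ℕ) {l : ℕ} (J : Nat.Partition l) : ℚ :=
  ∏ k ∈ J.parts.toFinset,
    alpha p k ^ J.parts.count k / ((J.parts.count k).factorial : ℚ)

/-- The polynomial `b_l(u,v) = ∑_J (-n)^{|J|} u^{J_o} v^{J_e} W_p(J)`, the sum being over the
partitions `J` of `l`; here `|J|`, `J_o`, `J_e` are the numbers of parts, of odd parts and of
even parts. -/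
def b (p n l : ℕ) (u v : ℚ) : ℚ :=
  ∑ J : Nat.Partition l,
    (-(n : ℚ)) ^ J.parts.card * u ^ (J.parts.filter (fun k => Odd k)).card
      * v ^ (J.parts.filter (fun k => Even k)).card * weight p J

/-- The value `P_k(m)`, fixed by
`∑_{h=0}^{m} (-1)^{h-1} (m choose h) h^N = (-1)^{m-1} P_{N-m}(m) N!` with `N = m + k`. -/
def P (k m : ℕ) : ℚ :=
  (∑ h ∈ Finset.range (m + 1), (-1 : ℚ) ^ (m + h) * (m.choose h : ℚ) * (h : ℚ) ^ (m + k))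
    / ((m + k).factorial : ℚ)

/-- The matrix `A^{i,r} = [b_{l + m(i-r)}(r + 2h, r)]`, `0 ≤ l ≤ m - i`, `0 ≤ h ≤ m - r`. -/
def block (p m n i r : ℕ) : Matrix (Fin (m - i + 1)) (Fin (m - r + 1)) ℚ :=
  Matrix.of fun l h => b p n (l + m * (i - r)) ((r : ℚ) + 2 * (h : ℕ)) (r : ℚ)

/-! ### The modular function `λ` and the modular equation -/

/-- `θ₂(τ) = ∑_{k ∈ ℤ} exp(π i (k + 1/2)² τ)`. -/
def theta2 (τ : ℂ) : ℂ :=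
  ∑' k : ℤ, Complex.exp (Real.pi * Complex.I * ((k : ℂ) + 1 / 2) ^ 2 * τ)

/-- `θ₃(τ) = ∑_{k ∈ ℤ} exp(π i k² τ)`. -/
def theta3 (τ : ℂ) : ℂ :=
  ∑' k : ℤ, Complex.exp (Real.pi * Complex.I * (k : ℂ) ^ 2 * τ)

/-- The modular function `λ = θ₂⁴ / θ₃⁴` on the upper half-plane. -/
def lam (τ : ℂ) : ℂ := theta2 τ ^ 4 / theta3 τ ^ 4

/-- `X` and `Y` are the holomorphic branches, on the upper half-plane, of
`(λ(τ) λ(pτ))^{n/8}` and `((1 - λ(τ)) (1 - λ(pτ)))^{n/8}` which satisfy `X ∼ 2ⁿ q^m` and `Y → 1`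
as `Im τ → ∞`, where `q = exp(π i τ)`. -/
structure IsRussellPair (p m n : ℕ) (X Y : ℂ → ℂ) : Prop where
  holoX : DifferentiableOn ℂ X {τ | 0 < τ.im}
  holoY : DifferentiableOn ℂ Y {τ | 0 < τ.im}
  powX : ∀ τ : ℂ, 0 < τ.im → X τ ^ 8 = (lam τ * lam (p * τ)) ^ n
  powY : ∀ τ : ℂ, 0 < τ.im → Y τ ^ 8 = ((1 - lam τ) * (1 - lam (p * τ))) ^ n
  limX : Filter.Tendsto (fun τ : ℂ => X τ / Complex.exp (Real.pi * Complex.I * τ) ^ m)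
    (Filter.comap Complex.im Filter.atTop) (nhds (2 ^ n))
  limY : Filter.Tendsto Y (Filter.comap Complex.im Filter.atTop) (nhds 1)

/-- `A` is the coefficient matrix of the Russell-type modular equation: an integer matrix,
normalised by `a_{0,0} = 1`, with `a_{i,h} = 0` for `i + h > m`, for which
`∑ a_{i,h} X^i Y^h` vanishes on the upper half-plane. -/
structure IsRussellMatrix (m : ℕ) (X Y : ℂ → ℂ)
    (A : Matrix (Fin (m + 1)) (Fin (m + 1)) ℤ) : Prop where
  normalized : A 0 0 = 1
  triangular : ∀ i h : Fin (m + 1), m < (i : ℕ) + (h : ℕ) → A i h = 0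
  vanishes : ∀ τ : ℂ, 0 < τ.im →
    ∑ i : Fin (m + 1), ∑ h : Fin (m + 1), (A i h : ℂ) * X τ ^ (i : ℕ) * Y τ ^ (h : ℕ) = 0

/-- The vector `A^{1,0} a₀`, where `a₀` is the `0`-th row of `A`. -/
def blockTimesRowZero (p m n : ℕ) (A : Matrix (Fin (m + 1)) (Fin (m + 1)) ℤ) :
    Fin (m - 1 + 1) → ℚ :=
  (block p m n 1 0).mulVec (fun h : Fin (m + 1) => (A 0 h : ℚ))

end Russell

end

/-!
Write `q = exp(π i τ)`. In the three cases the modular equation is a form of Russell's cubic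
`(1 - X - Y)³ = c X Y` with `c = 8 n³ / 2ⁿ`, that is `c = 32, 16, 4` for `p = 5, 11, 23`. Only
the congruence of the two sides modulo `q^8` is needed, because a relation
`∑ a_{i,h} Xⁱ Yʰ = 0` with `a_{0,0} = 1` is pinned down, apart from its coefficient at `X³`, by its
expansion up to `q^7`. Indeed `X ~ 2ⁿ q³` and `1 - Y ~ 2n q`. Hence `1`, `1 - Y`, `(1 - Y)²` have
exact orders `0, 1, 2`, and everything else in the relation has order at least `3`; together with
the normalization this gives `(1 - Y)³` as the part without `X`. The functions `X`, `X (1 - Y)`,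
`X (1 - Y)²`, `X²`, `X² (1 - Y)` then have the distinct orders `3, …, 7`, so that their
coefficients are determined one after the other (`Russell.eq_zero_of_eqMod_sum`,
`Russell.IsRussellMatrix.isCubic_of_eqMod`).

The congruence follows from the expansions of `X / q³` modulo `q^5` and of `Y` modulo `q^6`. The
theta series give those of `λ / (16 q)` and `1 - λ` (`Russell.lamUnit_eqMod`,
`Russell.one_sub_lam_eqMod`). The eighth powers of `X / q³` and `Y` are thereby known, and since
these functions have nonzero limits, a congruence between eighth powers descends to the functions
themselves (`Russell.EqMod.of_pow`). What remains is a polynomial identity in `q` for each `p`.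

With the entries of `A` known, the closed forms are evaluated: the values `α_p(k)` for `k ≤ 6` come
from divisor sums, and `b_l(u, v)` for `l ≤ 5` from the explicit list of the partitions of `l`.
-/

namespace Russell

/-! ### Partitions of integers up to five and the polynomials `b_l` -/

theorem exists_cons_of_sum_ne_zero {l : ℕ} (hl : l ≠ 0) {s : Multiset ℕ} (hs : s.sum = l)
    (h0 : 0 ∉ s) : ∃ a t, s = a ::ₘ t ∧ 0 < a ∧ a + t.sum = l ∧ 0 ∉ t := by
  rcases s.empty_or_exists_mem with rfl | ⟨a, ha⟩
  · exact absurd hs.symm hl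
  · obtain ⟨t, rfl⟩ := Multiset.exists_cons_of_mem ha
    simp only [Multiset.sum_cons, Multiset.mem_cons, not_or] at hs h0
    exact ⟨a, t, rfl, by omega, hs, h0.2⟩

/-- The partitions of `l`, as multisets of parts, for `l ≤ 5`; the empty list for larger `l`. -/
def partitionList : ℕ → List (Multiset ℕ)
  | 0 => [0]
  | 1 => [{1}]
  | 2 => [{2}, {1, 1}]
  | 3 => [{3}, {2, 1}, {1, 1, 1}]
  | 4 => [{4}, {3, 1}, {2, 2}, {2, 1, 1}, {1, 1, 1, 1}]
  | 5 => [{5}, {4, 1}, {3, 2}, {3, 1, 1}, {2, 2, 1}, {2, 1, 1, 1}, {1, 1, 1, 1, 1}]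
  | _ => []

theorem partitionList_nodup (l : ℕ) : (partitionList l).Nodup := by
  match l with
  | 0 | 1 | 2 | 3 | 4 | 5 => decide
  | _ + 6 => simp [partitionList]

theorem sum_of_mem_partitionList {l : ℕ} {s : Multiset ℕ} (hs : s ∈ partitionList l) :
    s.sum = l ∧ 0 ∉ s := by
  revert s
  match l with
  | 0 | 1 | 2 | 3 | 4 | 5 => decide
  | _ + 6 => simp [partitionList]

/-- Adding a part to a listed partition gives a listed partition; by induction on `l` this makes
the list complete. -/
theorem cons_mem_partitionList {a b : ℕ} (ha : 0 < a) (hab : a + b ≤ 5) {t : Multiset ℕ}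
    (ht : t ∈ partitionList b) : a ::ₘ t ∈ partitionList (a + b) := by
  have key : ∀ a : Fin 6, ∀ b : Fin 6, 0 < a.1 → a.1 + b.1 ≤ 5 →
      ∀ t ∈ partitionList b.1, a.1 ::ₘ t ∈ partitionList (a.1 + b.1) := by decide
  exact key ⟨a, by omega⟩ ⟨b, by omega⟩ ha hab t ht

theorem mem_partitionList {l : ℕ} (hl : l ≤ 5) {s : Multiset ℕ} (hs : s.sum = l)
    (h0 : 0 ∉ s) : s ∈ partitionList l := by
  induction l using Nat.strong_induction_on generalizing s with
  | _ l ih =>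
    rcases Nat.eq_zero_or_pos l with rfl | hpos
    · have : s = 0 := Multiset.eq_zero_of_forall_notMem fun a ha =>
        h0 ((Multiset.sum_eq_zero_iff.1 hs a ha) ▸ ha)
      simp [this, partitionList]
    · obtain ⟨a, t, rfl, ha, hat, ht⟩ := exists_cons_of_sum_ne_zero hpos.ne' hs h0
      subst hat
      exact cons_mem_partitionList ha hl (ih t.sum (by omega) (by omega) rfl ht)

theorem sum_partition_eq {l : ℕ} (hl : l ≤ 5) (F : Multiset ℕ → ℚ) :
    ∑ J : Nat.Partition l, F J.parts = ((partitionList l).map F).sum := by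
  rw [← List.sum_toFinset _ (partitionList_nodup l)]
  refine Finset.sum_bij (fun J _ => J.parts) ?_ ?_ ?_ ?_
  · exact fun J _ => List.mem_toFinset.2
      (mem_partitionList hl J.parts_sum fun h => (J.parts_pos h).ne' rfl)
  · exact fun J _ K _ h => Nat.Partition.ext h
  · intro s hs
    obtain ⟨hsum, h0⟩ := sum_of_mem_partitionList (List.mem_toFinset.1 hs)
    exact ⟨⟨s, fun {i} hi => Nat.pos_of_ne_zero (by rintro rfl; exact h0 hi), hsum⟩,
      Finset.mem_univ _, rfl⟩
  · exact fun _ _ => rfl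

theorem b_eq_sum_partitionList (p n : ℕ) {l : ℕ} (hl : l ≤ 5) (u v : ℚ) :
    b p n l u v = ((partitionList l).map fun s =>
      (-(n : ℚ)) ^ s.card * u ^ (s.filter (fun k => Odd k)).card
      * v ^ (s.filter (fun k => Even k)).card *
        ∏ k ∈ s.toFinset, alpha p k ^ s.count k / ((s.count k).factorial : ℚ)).sum := by
  rw [← sum_partition_eq hl]
  rfl

theorem b_zero (p n : ℕ) (u v : ℚ) : b p n 0 u v = 1 := by
  rw [b_eq_sum_partitionList p n (by norm_num)]
  simp [partitionList]

theorem b_one (p n : ℕ) (u v : ℚ) : b p n 1 u v = -(n * u * alpha p 1) := by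
  rw [b_eq_sum_partitionList p n (by norm_num)]
  simp [partitionList, Multiset.filter_singleton]

theorem b_two (p n : ℕ) (u v : ℚ) :
    b p n 2 u v = -(n * v * alpha p 2) + n ^ 2 * u ^ 2 * alpha p 1 ^ 2 / 2 := by
  rw [b_eq_sum_partitionList p n (by norm_num)]
  simp [partitionList, Multiset.filter_singleton, Nat.odd_iff, Nat.even_iff]
  ring

theorem b_three (p n : ℕ) (u v : ℚ) :
    b p n 3 u v = -(n * u * alpha p 3) + n ^ 2 * u * v * alpha p 2 * alpha p 1
      - n ^ 3 * u ^ 3 * alpha p 1 ^ 3 / 6 := by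
  rw [b_eq_sum_partitionList p n (by norm_num)]
  simp [partitionList, Multiset.filter_singleton, Nat.odd_iff, Nat.even_iff, Nat.factorial]
  ring

theorem b_four (p n : ℕ) (u v : ℚ) :
    b p n 4 u v = -(n * v * alpha p 4) + n ^ 2 * u ^ 2 * alpha p 3 * alpha p 1
      + n ^ 2 * v ^ 2 * alpha p 2 ^ 2 / 2 - n ^ 3 * u ^ 2 * v * alpha p 2 * alpha p 1 ^ 2 / 2
      + n ^ 4 * u ^ 4 * alpha p 1 ^ 4 / 24 := by
  rw [b_eq_sum_partitionList p n (by norm_num)]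
  simp [partitionList, Multiset.filter_singleton, Nat.odd_iff, Nat.even_iff, Nat.factorial]
  ring

theorem b_five (p n : ℕ) (u v : ℚ) :
    b p n 5 u v = -(n * u * alpha p 5) + n ^ 2 * u * v * alpha p 4 * alpha p 1
      + n ^ 2 * u * v * alpha p 3 * alpha p 2 - n ^ 3 * u ^ 3 * alpha p 3 * alpha p 1 ^ 2 / 2
      - n ^ 3 * u * v ^ 2 * alpha p 2 ^ 2 * alpha p 1 / 2
      + n ^ 4 * u ^ 3 * v * alpha p 2 * alpha p 1 ^ 3 / 6
      - n ^ 5 * u ^ 5 * alpha p 1 ^ 5 / 120 := by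
  rw [b_eq_sum_partitionList p n (by norm_num)]
  simp [partitionList, Multiset.filter_singleton, Nat.odd_iff, Nat.even_iff, Nat.factorial]
  ring

theorem sigmaQuot_of_lt {k d : ℕ} (hk : k ≠ 0) (hkd : k < d) : sigmaQuot k d = 0 :=
  if_neg (Nat.not_dvd_of_pos_of_lt (Nat.pos_of_ne_zero hk) hkd)

theorem alpha_of_lt {p k : ℕ} (hk : k ≠ 0) (hkp : k < p) :
    alpha p k = sigmaQuot k 1 - 3 * sigmaQuot k 2 + 2 * sigmaQuot k 4 := by
  simp [alpha, sigmaQuot_of_lt hk hkp, sigmaQuot_of_lt hk (show k < 2 * p by omega),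
    sigmaQuot_of_lt hk (show k < 4 * p by omega)]

theorem alpha_one {p : ℕ} (hp : 1 < p) : alpha p 1 = 1 := by
  rw [alpha_of_lt one_ne_zero hp]
  norm_num [sigmaQuot]

theorem sigma_values : ArithmeticFunction.sigma 1 2 = 3 ∧ ArithmeticFunction.sigma 1 3 = 4 ∧
    ArithmeticFunction.sigma 1 4 = 7 ∧ ArithmeticFunction.sigma 1 5 = 6 ∧
    ArithmeticFunction.sigma 1 6 = 12 := by
  decide

theorem alpha_two {p : ℕ} (hp : 2 < p) : alpha p 2 = -3 / 2 := by
  rw [alpha_of_lt two_ne_zero hp]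
  norm_num [sigmaQuot, sigma_values]

theorem alpha_three {p : ℕ} (hp : 3 < p) : alpha p 3 = 4 / 3 := by
  rw [alpha_of_lt three_ne_zero hp]
  norm_num [sigmaQuot, sigma_values]

theorem alpha_four {p : ℕ} (hp : 4 < p) : alpha p 4 = -3 / 4 := by
  rw [alpha_of_lt four_ne_zero hp]
  norm_num [sigmaQuot, sigma_values]

theorem alpha_five {p : ℕ} (hp : 5 < p) : alpha p 5 = 6 / 5 := by
  rw [alpha_of_lt (by norm_num) hp]
  norm_num [sigmaQuot, sigma_values]

theorem alpha_five_five : alpha 5 5 = 11 / 5 := by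
  norm_num [alpha, sigmaQuot, sigma_values]

theorem alpha_six {p : ℕ} (hp : 6 < p) : alpha p 6 = -2 := by
  rw [alpha_of_lt (by norm_num) hp]
  norm_num [sigmaQuot, sigma_values]

theorem alpha_five_six : alpha 5 6 = -2 := by
  norm_num [alpha, sigmaQuot, sigma_values]

theorem P_one_three : P 1 3 = 3 / 2 := by
  norm_num [P, Finset.sum_range_succ, Nat.choose, Nat.factorial]

theorem P_two_three : P 2 3 = 5 / 4 := by
  norm_num [P, Finset.sum_range_succ, Nat.choose, Nat.factorial]

theorem P_four_three : P 4 3 = 43 / 120 := by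
  norm_num [P, Finset.sum_range_succ, Nat.choose, Nat.factorial]

/-! ### Congruences modulo powers of the nome -/

open Filter Topology Asymptotics

/-- The filter `Im τ → ∞`. -/
abbrev imInfty : Filter ℂ := comap Complex.im atTop

/-- The nome `q = exp(π i τ)`. -/
noncomputable def nome (τ : ℂ) : ℂ := Complex.exp (Real.pi * Complex.I * τ)

/-- `f ≡ g` modulo `O(q^N)` as `Im τ → ∞`. -/
def EqMod (N : ℕ) (f g : ℂ → ℂ) : Prop :=
  (fun τ => f τ - g τ) =O[imInfty] fun τ => nome τ ^ N

theorem nome_ne_zero (τ : ℂ) : nome τ ≠ 0 := Complex.exp_ne_zero _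

theorem eventually_im_pos : ∀ᶠ τ in imInfty, 0 < Complex.im τ :=
  tendsto_comap.eventually (eventually_gt_atTop 0)

theorem tendsto_nome : Tendsto nome imInfty (𝓝 0) := by
  refine Complex.tendsto_exp_comap_re_atBot.comp (tendsto_comap_iff.2 ?_)
  have h : (Complex.re ∘ fun τ : ℂ => Real.pi * Complex.I * τ)
      = fun τ : ℂ => -Real.pi * τ.im := by
    ext τ; simp
  rw [h]
  exact tendsto_comap.const_mul_atTop_of_neg (neg_lt_zero.2 Real.pi_pos)

theorem tendsto_comp_nome {P : ℂ → ℂ} (hP : Continuous P) :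
    Tendsto (fun τ => P (nome τ)) imInfty (𝓝 (P 0)) :=
  (hP.tendsto 0).comp tendsto_nome

theorem isBigO_one_comp_nome {P : ℂ → ℂ} (hP : Continuous P) :
    (fun τ => P (nome τ)) =O[imInfty] fun _ => (1 : ℂ) :=
  (tendsto_comp_nome hP).isBigO_one ℂ

namespace EqMod

variable {N M : ℕ} {f g h f' g' : ℂ → ℂ}

theorem refl (N : ℕ) (f : ℂ → ℂ) : EqMod N f f := by
  simp only [EqMod, sub_self]
  exact isBigO_zero _ _

theorem symm (H : EqMod N f g) : EqMod N g f := by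
  refine H.neg_left.congr_left fun τ => ?_
  ring

theorem trans (H : EqMod N f g) (H' : EqMod N g h) : EqMod N f h := by
  refine (H.add H').congr_left fun τ => ?_
  ring

theorem congr' (H : EqMod N f g) (hf : f =ᶠ[imInfty] f') (hg : g =ᶠ[imInfty] g') :
    EqMod N f' g' :=
  IsBigO.congr' H (hf.sub hg) EventuallyEq.rfl

theorem add (H : EqMod N f g) (H' : EqMod N f' g') :
    EqMod N (fun τ => f τ + f' τ) fun τ => g τ + g' τ := by
  refine (IsBigO.add H H').congr_left fun τ => ?_
  ring

theorem sub (H : EqMod N f g) (H' : EqMod N f' g') :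
    EqMod N (fun τ => f τ - f' τ) fun τ => g τ - g' τ := by
  refine (IsBigO.sub H H').congr_left fun τ => ?_
  ring

theorem mono (hMN : M ≤ N) (H : EqMod N f g) : EqMod M f g := by
  refine IsBigO.trans H ?_
  have := (isBigO_one_comp_nome (continuous_pow (N - M))).mul
    (isBigO_refl (fun τ => nome τ ^ M) imInfty)
  refine this.congr (fun τ => ?_) fun τ => one_mul _
  rw [← pow_add, Nat.sub_add_cancel hMN]

/-- A function congruent to a bounded one is bounded; this makes `EqMod` multiplicative on bounded
functions. -/
theorem isBigO_one (H : EqMod N f g) (hg : g =O[imInfty] fun _ => (1 : ℂ)) :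
    f =O[imInfty] fun _ => (1 : ℂ) := by
  have := (IsBigO.trans H (isBigO_one_comp_nome (continuous_pow N))).add hg
  exact this.congr_left fun τ => sub_add_cancel _ _

theorem mul (H : EqMod N f g) (H' : EqMod N f' g')
    (hg : g =O[imInfty] fun _ => (1 : ℂ)) (hg' : g' =O[imInfty] fun _ => (1 : ℂ)) :
    EqMod N (fun τ => f τ * f' τ) fun τ => g τ * g' τ := by
  have h1 := (H'.isBigO_one hg').mul H
  have h2 := hg.mul H'
  simp only [one_mul] at h1 h2
  refine (h1.add h2).congr_left fun τ => ?_
  ring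

theorem pow (H : EqMod N f g) (hg : g =O[imInfty] fun _ => (1 : ℂ)) (k : ℕ) :
    EqMod N (fun τ => f τ ^ k) fun τ => g τ ^ k := by
  induction k with
  | zero => simpa using refl N _
  | succ k ih =>
    simp only [pow_succ]
    exact ih.mul H (by simpa using hg.pow k) hg

theorem const_mul (c : ℂ) (H : EqMod N f g) :
    EqMod N (fun τ => c * f τ) fun τ => c * g τ := by
  refine (IsBigO.const_mul_left H c).congr_left fun τ => ?_
  ring

theorem nome_pow_mul (k : ℕ) (H : EqMod N f g) :
    EqMod (N + k) (fun τ => nome τ ^ k * f τ) fun τ => nome τ ^ k * g τ := by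
  refine ((isBigO_refl (fun τ => nome τ ^ k) imInfty).mul H).congr (fun τ => ?_) fun τ => ?_
  · ring
  · ring

theorem of_nome_mul (H : EqMod (N + 1) (fun τ => nome τ * f τ) fun τ => nome τ * g τ) :
    EqMod N f g := by
  refine ((isBigO_refl (fun τ => (nome τ)⁻¹) imInfty).mul H).congr (fun τ => ?_) fun τ => ?_
  · rw [← mul_sub, inv_mul_cancel_left₀ (nome_ne_zero τ)]
  · rw [pow_succ', inv_mul_cancel_left₀ (nome_ne_zero τ)]

/-- Cancellation of a factor with a nonzero limit. -/
theorem of_mul_right {c : ℂ} (hc : c ≠ 0) (hh : Tendsto h imInfty (𝓝 c))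
    (H : EqMod N (fun τ => f τ * h τ) fun τ => g τ * h τ) : EqMod N f g := by
  have h1 := ((hh.inv₀ hc).isBigO_one ℂ).mul H
  simp only [one_mul] at h1
  refine h1.congr' ?_ EventuallyEq.rfl
  filter_upwards [hh.eventually_ne hc] with τ hτ
  field_simp

/-- Roots of congruent functions are congruent if they have the same nonzero limit. -/
theorem of_pow {c : ℂ} (hc : c ≠ 0) {k : ℕ} (hk : k ≠ 0) (hf : Tendsto f imInfty (𝓝 c))
    (hg : Tendsto g imInfty (𝓝 c)) (H : EqMod N (fun τ => f τ ^ k) fun τ => g τ ^ k) :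
    EqMod N f g := by
  have hS : Tendsto (fun τ => ∑ i ∈ Finset.range k, f τ ^ i * g τ ^ (k - 1 - i)) imInfty
      (𝓝 (k * c ^ (k - 1))) := by
    have : Tendsto (fun τ => ∑ i ∈ Finset.range k, f τ ^ i * g τ ^ (k - 1 - i)) imInfty
        (𝓝 (∑ i ∈ Finset.range k, c ^ i * c ^ (k - 1 - i))) :=
      tendsto_finsetSum _ fun i _ => (hf.pow i).mul (hg.pow _)
    convert this using 2
    rw [Finset.sum_congr rfl (g := fun _ => c ^ (k - 1)), Finset.sum_const, Finset.card_range,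
      nsmul_eq_mul]
    intro i hi
    rw [← pow_add]
    congr 1
    have := Finset.mem_range.1 hi
    omega
  refine of_mul_right (mul_ne_zero (Nat.cast_ne_zero.2 hk) (pow_ne_zero (k - 1) hc)) hS ?_
  refine IsBigO.congr_left H fun τ => ?_
  rw [← sub_mul, mul_comm, geom_sum₂_mul]

/-- Two polynomial expressions in `q` are congruent modulo `q^N` when their difference is
`x ^ N` times a continuous cofactor `R`. -/
theorem of_eq_pow_mul {P Q : ℂ → ℂ} (R : ℂ → ℂ) (hR : Continuous R)
    (hPQ : ∀ x, P x - Q x = x ^ N * R x) :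
    EqMod N (fun τ => P (nome τ)) fun τ => Q (nome τ) := by
  refine ((isBigO_refl (fun τ => nome τ ^ N) imInfty).mul
    (isBigO_one_comp_nome hR)).congr (fun τ => ?_) fun τ => mul_one _
  exact (hPQ _).symm

end EqMod

/-- If `∑_{j < N} c_j q^j W_j` vanishes modulo `q^N`, where each `W_j` has a nonzero limit, then
all `c_j` vanish: the `j`-th summand has exact order `j` in `q`. -/
theorem eq_zero_of_eqMod_sum {N : ℕ} {c w : ℕ → ℂ} {W : ℕ → ℂ → ℂ}
    (hw : ∀ j < N, w j ≠ 0) (hW : ∀ j < N, Tendsto (W j) imInfty (𝓝 (w j)))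
    (H : EqMod N (fun τ => ∑ j ∈ Finset.range N, c j * nome τ ^ j * W j τ) fun _ => 0) :
    ∀ j < N, c j = 0 := by
  intro j
  induction j using Nat.strong_induction_on with
  | _ j ih =>
    intro hj
    have hrest : (fun τ => ∑ i ∈ Finset.Ico (j + 1) N, c i * nome τ ^ i * W i τ) =O[imInfty]
        fun τ => nome τ ^ (j + 1) := by
      refine IsBigO.fun_sum fun i hi => ?_
      obtain ⟨hi1, hi2⟩ := Finset.mem_Ico.1 hi
      have h1 : (fun τ => nome τ ^ i) =O[imInfty] fun τ => nome τ ^ (j + 1) := by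
        have h0 : EqMod i (fun τ => nome τ ^ i) fun _ => 0 := by
          exact (isBigO_refl (fun τ => nome τ ^ i) imInfty).congr_left fun τ => (sub_zero _).symm
        exact (h0.mono hi1).congr_left fun τ => sub_zero _
      simpa only [mul_one] using (h1.const_mul_left (c i)).mul ((hW i hi2).isBigO_one ℂ)
    have hall : (fun τ => ∑ i ∈ Finset.range N, c i * nome τ ^ i * W i τ) =O[imInfty]
        fun τ => nome τ ^ (j + 1) := by
      exact (H.mono (show j + 1 ≤ N from hj)).congr_left fun τ => sub_zero _
    have hsub := hall.sub hrest
    have hterm : (fun τ => nome τ ^ j * (c j * W j τ)) =O[imInfty]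
        fun τ => nome τ ^ j * nome τ := by
      refine hsub.congr (fun τ => ?_) fun τ => pow_succ _ _
      rw [← Finset.sum_range_add_sum_Ico _ (show j + 1 ≤ N from hj), Finset.sum_range_succ,
        Finset.sum_eq_zero fun i hi => ?_]
      · ring
      · have hi' := Finset.mem_range.1 hi
        rw [ih i hi' (by omega), zero_mul, zero_mul]
    have hlim : Tendsto (fun τ => c j * W j τ) imInfty (𝓝 0) := by
      have h3 := (isBigO_refl (fun τ => (nome τ ^ j)⁻¹) imInfty).mul hterm
      have h4 : (fun τ => c j * W j τ) =O[imInfty] nome := by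
        refine h3.congr (fun τ => ?_) fun τ => ?_
        · rw [inv_mul_cancel_left₀ (pow_ne_zero j (nome_ne_zero τ))]
        · rw [inv_mul_cancel_left₀ (pow_ne_zero j (nome_ne_zero τ))]
      exact h4.trans_tendsto tendsto_nome
    have : NeBot imInfty := by
      rw [imInfty, comap_neBot_iff]
      intro t ht
      obtain ⟨y, hy⟩ := (atTop : Filter ℝ).nonempty_of_mem ht
      exact ⟨⟨0, y⟩, hy⟩
    have := tendsto_nhds_unique hlim ((hW j hj).const_mul (c j))
    exact (mul_eq_zero.1 this.symm).resolve_right (hw j hj)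

/-! ### Expansions of the theta functions and of `λ` -/

theorem norm_nome_lt_one {τ : ℂ} (hτ : 0 < τ.im) : ‖nome τ‖ < 1 := by
  rw [nome, Complex.norm_exp, Real.exp_lt_one_iff]
  have : (Real.pi * Complex.I * τ).re = -(Real.pi * τ.im) := by simp
  rw [this]
  exact neg_lt_zero.2 (mul_pos Real.pi_pos hτ)

theorem summable_pow_of_le {x : ℂ} (hx : ‖x‖ < 1) {e : ℕ → ℕ} (he : ∀ k, k ≤ e k) :
    Summable fun k => x ^ e k := by
  refine Summable.of_norm_bounded (summable_geometric_of_lt_one (norm_nonneg x) hx) fun k => ?_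
  rw [norm_pow]
  exact pow_le_pow_of_le_one (norm_nonneg x) hx.le (he k)

/-- A lacunary series in the nome agrees with its first `j` terms modulo `q^N` as soon as the
later exponents are at least `N, N + 1, N + 2, …`. -/
theorem eqMod_tsum_nome_pow {N j : ℕ} {e : ℕ → ℕ} (he : ∀ k, N + k ≤ e (k + j)) :
    EqMod N (fun τ => ∑' k, nome τ ^ e k) fun τ => ∑ k ∈ Finset.range j, nome τ ^ e k := by
  have hhalf : ∀ᶠ τ in imInfty, ‖nome τ‖ < 1 / 2 :=
    (tendsto_zero_iff_norm_tendsto_zero.1 tendsto_nome).eventually (gt_mem_nhds (by norm_num))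
  refine IsBigO.of_bound 2 ?_
  filter_upwards [hhalf] with τ hτ
  have h1 : ‖nome τ‖ < 1 := hτ.trans (by norm_num)
  have hgeom := (hasSum_geometric_of_lt_one (norm_nonneg (nome τ)) h1).mul_left (‖nome τ‖ ^ N)
  have hbound : ∀ k, ‖nome τ ^ e (k + j)‖ ≤ ‖nome τ‖ ^ N * ‖nome τ‖ ^ k := fun k => by
    rw [norm_pow, ← pow_add]
    exact pow_le_pow_of_le_one (norm_nonneg _) h1.le (he k)
  have htail : Summable fun k => nome τ ^ e (k + j) :=
    Summable.of_norm_bounded hgeom.summable hbound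
  have hall : Summable fun k => nome τ ^ e k := (summable_nat_add_iff j).1 htail
  rw [← hall.sum_add_tsum_nat_add j, add_sub_cancel_left]
  refine (tsum_of_norm_bounded hgeom hbound).trans ?_
  rw [norm_pow, mul_comm]
  refine mul_le_mul_of_nonneg_right ?_ (by positivity)
  rw [inv_le_comm₀ (by linarith) (by norm_num)]
  linarith

/-- The series `∑_{k ≥ 0} q^{k(k+1)}`, which is `θ₂ / (2 q^{1/4})`. -/
noncomputable def psi (τ : ℂ) : ℂ := ∑' k : ℕ, nome τ ^ (k * (k + 1))

theorem theta3_eq {τ : ℂ} (hτ : 0 < τ.im) :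
    theta3 τ = 1 + 2 * ∑' k : ℕ, nome τ ^ (k + 1) ^ 2 := by
  refine (jacobiTheta_eq_tsum_nat hτ).trans ?_
  congr 3 with k
  rw [nome, ← Complex.exp_nat_mul]
  push_cast
  congr 1
  ring

/-- The terms of `θ₂` with index `k` and `-k-1` agree. -/
theorem theta2_eq {τ : ℂ} (hτ : 0 < τ.im) :
    theta2 τ = 2 * Complex.exp (Real.pi * Complex.I * τ / 4) * psi τ := by
  have hs : HasSum (fun k : ℕ => Complex.exp (Real.pi * Complex.I * τ / 4) *
      nome τ ^ (k * (k + 1))) (Complex.exp (Real.pi * Complex.I * τ / 4) * psi τ) :=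
    (summable_pow_of_le (norm_nome_lt_one hτ) fun k =>
      Nat.le_mul_of_pos_right k k.succ_pos).hasSum.mul_left _
  have hterm : ∀ k : ℕ, Complex.exp (Real.pi * Complex.I * τ / 4) * nome τ ^ (k * (k + 1)) =
      Complex.exp (Real.pi * Complex.I * ((k : ℂ) + 1 / 2) ^ 2 * τ) := fun k => by
    rw [nome, ← Complex.exp_nat_mul, ← Complex.exp_add]
    push_cast
    congr 1
    ring
  have hpos : HasSum (fun k : ℕ =>
      Complex.exp (Real.pi * Complex.I * (((k : ℤ) : ℂ) + 1 / 2) ^ 2 * τ))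
      (Complex.exp (Real.pi * Complex.I * τ / 4) * psi τ) := by
    simpa only [hterm, Int.cast_natCast] using hs
  have hneg : HasSum (fun k : ℕ =>
      Complex.exp (Real.pi * Complex.I * (((-((k : ℤ) + 1) : ℤ) : ℂ) + 1 / 2) ^ 2 * τ))
      (Complex.exp (Real.pi * Complex.I * τ / 4) * psi τ) := by
    convert hpos using 4
    push_cast
    ring
  rw [theta2, (hpos.of_nat_of_neg_add_one
    (f := fun k : ℤ => Complex.exp (Real.pi * Complex.I * ((k : ℂ) + 1 / 2) ^ 2 * τ)) hneg).tsum_eq]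
  ring

theorem theta2_pow_four {τ : ℂ} (hτ : 0 < τ.im) :
    theta2 τ ^ 4 = 16 * nome τ * psi τ ^ 4 := by
  have : Complex.exp (Real.pi * Complex.I * τ / 4) ^ 4 = nome τ := by
    rw [nome, ← Complex.exp_nat_mul]
    push_cast
    congr 1
    ring
  rw [theta2_eq hτ, mul_pow, mul_pow, this]
  ring

theorem psi_eqMod : EqMod 6 psi fun τ => 1 + nome τ ^ 2 := by
  have := eqMod_tsum_nome_pow (N := 6) (j := 2) (e := fun k => k * (k + 1))
    fun k => by ring_nf; omega
  simpa [Finset.sum_range_succ, psi] using! this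

theorem theta3_eqMod : EqMod 6 theta3 fun τ => 1 + 2 * nome τ + 2 * nome τ ^ 4 := by
  have := eqMod_tsum_nome_pow (N := 6) (j := 2) (e := fun k => (k + 1) ^ 2)
    fun k => by ring_nf; omega
  refine ((EqMod.refl 6 fun _ => 1).add (this.const_mul 2)).congr' ?_ ?_
  · filter_upwards [eventually_im_pos] with τ hτ
    exact (theta3_eq hτ).symm
  · refine Eventually.of_forall fun τ => ?_
    simp [Finset.sum_range_succ]
    ring

/-- Congruent functions have the same limit, for a modulus of positive degree. -/
theorem EqMod.tendsto {N : ℕ} (hN : N ≠ 0) {f g : ℂ → ℂ} {c : ℂ} (H : EqMod N f g)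
    (hg : Tendsto g imInfty (𝓝 c)) : Tendsto f imInfty (𝓝 c) := by
  have h0 : Tendsto (fun τ => nome τ ^ N) imInfty (𝓝 0) := by
    simpa [hN] using tendsto_nome.pow N
  simpa using (H.trans_tendsto h0).add hg

theorem tendsto_theta3 : Tendsto theta3 imInfty (𝓝 1) := by
  have := tendsto_comp_nome (P := fun x => 1 + 2 * x + 2 * x ^ 4) (by fun_prop)
  exact theta3_eqMod.tendsto (by norm_num) (by simpa using this)

/-- The function `λ / (16 q) = (θ₂ / (2 q^{1/4} θ₃))⁴`. -/
noncomputable def lamUnit (τ : ℂ) : ℂ := psi τ ^ 4 / theta3 τ ^ 4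

theorem lam_eq {τ : ℂ} (hτ : 0 < τ.im) : lam τ = 16 * nome τ * lamUnit τ := by
  rw [lam, theta2_pow_four hτ, lamUnit, mul_div_assoc]

/-- The expansion of `(λ / (16 q))^{1/8} = ∏ (1 + q^{2k}) / (1 + q^{2k-1})` up to `q^4`. -/
def rootLam (x : ℂ) : ℂ := 1 - x + 2 * x ^ 2 - 3 * x ^ 3 + 4 * x ^ 4

/-- The expansion of `(1 - λ)^{1/8} = ∏ (1 - q^{2k-1}) / (1 + q^{2k-1})` up to `q^5`. -/
def rootOneSubLam (x : ℂ) : ℂ := 1 - 2 * x + 2 * x ^ 2 - 4 * x ^ 3 + 6 * x ^ 4 - 8 * x ^ 5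

theorem continuous_rootLam : Continuous rootLam := by
  unfold rootLam; fun_prop

theorem continuous_rootOneSubLam : Continuous rootOneSubLam := by
  unfold rootOneSubLam; fun_prop

/-- Taking fourth roots reduces this to `ψ ≡ rootLam(q)² θ₃`. -/
theorem lamUnit_eqMod : EqMod 5 lamUnit fun τ => rootLam (nome τ) ^ 8 := by
  refine EqMod.of_mul_right one_ne_zero (by simpa using tendsto_theta3.pow 4) ?_
  have hpoly : EqMod 5 (fun τ => 1 + nome τ ^ 2)
      fun τ => rootLam (nome τ) ^ 2 * (1 + 2 * nome τ + 2 * nome τ ^ 4) :=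
    EqMod.of_eq_pow_mul (P := fun x => 1 + x ^ 2)
      (Q := fun x => rootLam x ^ 2 * (1 + 2 * x + 2 * x ^ 4))
      (fun x => -12 + 5 * x - 6 * x ^ 2 - 4 * x ^ 3 + 8 * x ^ 4 - 50 * x ^ 5 + 48 * x ^ 6
        - 32 * x ^ 7) (by fun_prop) fun x => by simp only [rootLam]; ring
  have hroot : EqMod 5 psi fun τ => rootLam (nome τ) ^ 2 * theta3 τ := by
    refine ((psi_eqMod.mono (by norm_num)).trans hpoly).trans ?_
    refine (EqMod.refl 5 _).mul (theta3_eqMod.mono (by norm_num)).symm ?_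
      (tendsto_theta3.isBigO_one ℂ)
    exact isBigO_one_comp_nome (continuous_rootLam.pow 2)
  refine (hroot.pow ?_ 4).congr' ?_ (Eventually.of_forall fun τ => by ring)
  · simpa using (isBigO_one_comp_nome (continuous_rootLam.pow 2)).mul
      (tendsto_theta3.isBigO_one ℂ)
  · filter_upwards [tendsto_theta3.eventually_ne one_ne_zero] with τ hτ
    rw [lamUnit, div_mul_cancel₀ _ (pow_ne_zero 4 hτ)]

/-- Modulo `q^6`, the polynomial identity behind this is Jacobi's `θ₃⁴ - θ₂⁴ = θ₄⁴`. -/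
theorem one_sub_lam_eqMod :
    EqMod 6 (fun τ => 1 - lam τ) fun τ => rootOneSubLam (nome τ) ^ 8 := by
  refine EqMod.of_mul_right one_ne_zero (by simpa using tendsto_theta3.pow 4) ?_
  have hθ : (fun τ => 1 + 2 * nome τ + 2 * nome τ ^ 4) =O[imInfty] fun _ => (1 : ℂ) :=
    isBigO_one_comp_nome (P := fun x => 1 + 2 * x + 2 * x ^ 4) (by fun_prop)
  have hψ : (fun τ => 1 + nome τ ^ 2) =O[imInfty] fun _ => (1 : ℂ) :=
    isBigO_one_comp_nome (P := fun x => 1 + x ^ 2) (by fun_prop)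
  have hjac : EqMod 6
      (fun τ => (1 + 2 * nome τ + 2 * nome τ ^ 4) ^ 4 - 16 * nome τ * (1 + nome τ ^ 2) ^ 4)
      fun τ => (1 - 2 * nome τ + 2 * nome τ ^ 4) ^ 4 :=
    EqMod.of_eq_pow_mul (P := fun x => (1 + 2 * x + 2 * x ^ 4) ^ 4 - 16 * x * (1 + x ^ 2) ^ 4)
      (Q := fun x => (1 - 2 * x + 2 * x ^ 4) ^ 4)
      (fun x => 64 * x + 176 * x ^ 3 + 128 * x ^ 7) (by fun_prop) fun x => by ring
  have hpoly : EqMod 6 (fun τ => 1 - 2 * nome τ + 2 * nome τ ^ 4)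
      fun τ => rootOneSubLam (nome τ) ^ 2 * (1 + 2 * nome τ + 2 * nome τ ^ 4) :=
    EqMod.of_eq_pow_mul (P := fun x => 1 - 2 * x + 2 * x ^ 4)
      (Q := fun x => rootOneSubLam x ^ 2 * (1 + 2 * x + 2 * x ^ 4))
      (fun x => 24 - 32 * x - 4 * x ^ 2 + 8 * x ^ 3 - 16 * x ^ 4 + 32 * x ^ 5 - 200 * x ^ 6
        + 192 * x ^ 7 - 128 * x ^ 8) (by fun_prop) fun x => by simp only [rootOneSubLam]; ring
  have hroot : EqMod 6 (fun τ => 1 - 2 * nome τ + 2 * nome τ ^ 4)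
      fun τ => rootOneSubLam (nome τ) ^ 2 * theta3 τ :=
    hpoly.trans ((EqMod.refl 6 _).mul theta3_eqMod.symm
      (isBigO_one_comp_nome (continuous_rootOneSubLam.pow 2)) (tendsto_theta3.isBigO_one ℂ))
  have hleft : EqMod 6 (fun τ => theta3 τ ^ 4 - 16 * nome τ * psi τ ^ 4)
      fun τ => (1 + 2 * nome τ + 2 * nome τ ^ 4) ^ 4 - 16 * nome τ * (1 + nome τ ^ 2) ^ 4 := by
    refine (theta3_eqMod.pow hθ 4).sub ((EqMod.refl 6 fun τ => 16 * nome τ).mul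
      (psi_eqMod.pow hψ 4) ?_ ?_)
    · exact isBigO_one_comp_nome (P := fun x => 16 * x) (by fun_prop)
    · simpa using hψ.pow 4
  refine ((hleft.trans hjac).trans (hroot.pow ?_ 4)).congr' ?_
    (Eventually.of_forall fun τ => by ring)
  · simpa using (isBigO_one_comp_nome (continuous_rootOneSubLam.pow 2)).mul
      (tendsto_theta3.isBigO_one ℂ)
  · filter_upwards [tendsto_theta3.eventually_ne one_ne_zero, eventually_im_pos] with τ hτ hτ'
    rw [lam, theta2_pow_four hτ']
    field_simp

/-! ### Expansions at `pτ` -/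

theorem nome_natCast_mul (p : ℕ) (τ : ℂ) : nome (p * τ) = nome τ ^ p := by
  rw [nome, nome, ← Complex.exp_nat_mul]
  congr 1
  ring

theorem tendsto_natCast_mul {p : ℕ} (hp : 0 < p) :
    Tendsto (fun τ : ℂ => (p : ℂ) * τ) imInfty imInfty := by
  refine tendsto_comap_iff.2 ?_
  have h : (Complex.im ∘ fun τ : ℂ => (p : ℂ) * τ) = fun τ : ℂ => (p : ℝ) * τ.im := by
    ext τ; simp
  rw [h]
  exact tendsto_comap.const_mul_atTop (Nat.cast_pos.2 hp)

theorem EqMod.comp_natCast_mul {N p : ℕ} (hp : 0 < p) {f g : ℂ → ℂ} (H : EqMod N f g) :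
    EqMod (p * N) (fun τ => f (p * τ)) fun τ => g (p * τ) := by
  refine (IsBigO.comp_tendsto H (tendsto_natCast_mul hp)).congr_right fun τ => ?_
  simp only [Function.comp, nome_natCast_mul, pow_mul]

theorem lamUnit_natCast_mul_eqMod {p : ℕ} (hp : 5 ≤ p) :
    EqMod 5 (fun τ => lamUnit (p * τ)) fun _ => 1 := by
  have h1 : EqMod 1 lamUnit fun _ => 1 := by
    refine (lamUnit_eqMod.mono (by norm_num)).trans ?_
    refine EqMod.of_eq_pow_mul (P := fun x => rootLam x ^ 8) (Q := fun _ => 1)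
      (fun x => (-1 + 2 * x - 3 * x ^ 2 + 4 * x ^ 3) *
        ∑ i ∈ Finset.range 8, rootLam x ^ i) ?_ fun x => ?_
    · have := continuous_rootLam
      fun_prop
    · rw [← geom_sum_mul]
      simp only [rootLam]
      ring
  exact (h1.comp_natCast_mul (by omega)).mono (by omega)

theorem one_sub_lam_natCast_mul_eqMod {p : ℕ} (hp : 5 ≤ p) :
    EqMod 6 (fun τ => 1 - lam (p * τ)) fun τ => (1 - 2 * nome τ ^ p) ^ 8 := by
  have h2 : EqMod 2 (fun τ => 1 - lam τ) fun τ => (1 - 2 * nome τ) ^ 8 := by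
    refine (one_sub_lam_eqMod.mono (by norm_num)).trans ?_
    have hroot : EqMod 2 (fun τ => rootOneSubLam (nome τ)) fun τ => 1 - 2 * nome τ :=
      EqMod.of_eq_pow_mul (P := rootOneSubLam) (Q := fun x => 1 - 2 * x)
        (fun x => 2 - 4 * x + 6 * x ^ 2 - 8 * x ^ 3) (by fun_prop)
        fun x => by simp only [rootOneSubLam]; ring
    exact hroot.pow (isBigO_one_comp_nome (P := fun x => 1 - 2 * x) (by fun_prop)) 8
  have := (h2.comp_natCast_mul (p := p) (by omega)).mono (show 6 ≤ p * 2 by omega)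
  simpa only [nome_natCast_mul] using this

/-! ### Expansions of `X` and `Y` -/

section Pair

variable {p m n : ℕ} {X Y : ℂ → ℂ}

/-- `(X / q^m)⁸ = (256 · λ(τ)/(16q) · λ(pτ)/(16q^p))ⁿ`, and the second quotient is `1` modulo
`q^5`; the limit of `X / q^m` selects the eighth root. -/
theorem IsRussellPair.X_div_eqMod (H : IsRussellPair p m n X Y) (hp : 5 ≤ p)
    (hpmn : (p + 1) * n = 8 * m) :
    EqMod 5 (fun τ => X τ / nome τ ^ m) fun τ => 2 ^ n * rootLam (nome τ) ^ n := by
  have hlim : Tendsto (fun τ => 2 ^ n * rootLam (nome τ) ^ n) imInfty (𝓝 (2 ^ n)) := by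
    have hc := continuous_rootLam
    have := tendsto_comp_nome (P := fun x => 2 ^ n * rootLam x ^ n) (by fun_prop)
    simpa [rootLam] using this
  refine EqMod.of_pow (k := 8) (pow_ne_zero n two_ne_zero) (by norm_num) H.limX hlim ?_
  have hprod : EqMod 5 (fun τ => 256 * (lamUnit τ * lamUnit (p * τ)))
      fun τ => 256 * (rootLam (nome τ) ^ 8 * 1) :=
    (lamUnit_eqMod.mul (lamUnit_natCast_mul_eqMod hp)
      (isBigO_one_comp_nome (continuous_rootLam.pow 8)) (isBigO_refl _ _)).const_mul 256
  refine (hprod.pow ?_ n).congr' ?_ ?_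
  · have hc := continuous_rootLam
    exact isBigO_one_comp_nome (P := fun x => 256 * (rootLam x ^ 8 * 1)) (by fun_prop)
  · filter_upwards [eventually_im_pos] with τ hτ
    have hτp : 0 < ((p : ℂ) * τ).im := by
      have : ((p : ℂ) * τ).im = p * τ.im := by simp
      rw [this]
      have : (0 : ℝ) < p := Nat.cast_pos.2 (by omega)
      positivity
    have hq : (nome τ ^ m) ^ 8 = (nome τ * nome τ ^ p) ^ n := by
      rw [← pow_mul, ← pow_succ', ← pow_mul, hpmn, mul_comm]
    rw [div_pow, H.powX τ hτ, lam_eq hτ, lam_eq hτp, nome_natCast_mul, hq, ← div_pow]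
    congr 1
    have := nome_ne_zero τ
    field_simp
    ring
  · refine Eventually.of_forall fun τ => ?_
    have h256 : (256 : ℂ) = 2 ^ 8 := by norm_num
    simp only [mul_one, h256, ← mul_pow, ← pow_mul, Nat.mul_comm 8 n]

/-- As `1 - λ(pτ) ≡ 1 - 16 q^p ≡ (1 - 2 q^p)⁸` modulo `q^6`, only `p = 5` contributes a correction
from the second factor. -/
theorem IsRussellPair.Y_eqMod (H : IsRussellPair p m n X Y) (hp : 5 ≤ p) :
    EqMod 6 Y fun τ => (rootOneSubLam (nome τ) * (1 - 2 * nome τ ^ p)) ^ n := by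
  have hc := continuous_rootOneSubLam
  have hlim : Tendsto (fun τ => (rootOneSubLam (nome τ) * (1 - 2 * nome τ ^ p)) ^ n) imInfty
      (𝓝 1) := by
    have := tendsto_comp_nome (P := fun x => (rootOneSubLam x * (1 - 2 * x ^ p)) ^ n)
      (by fun_prop)
    simpa [rootOneSubLam, show p ≠ 0 by omega] using this
  refine EqMod.of_pow (k := 8) one_ne_zero (by norm_num) H.limY hlim ?_
  refine ((one_sub_lam_eqMod.mul (one_sub_lam_natCast_mul_eqMod hp)
    (isBigO_one_comp_nome (hc.pow 8)) ?_).pow ?_ n).congr' ?_ ?_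
  · exact isBigO_one_comp_nome (P := fun x => (1 - 2 * x ^ p) ^ 8) (by fun_prop)
  · exact isBigO_one_comp_nome (P := fun x => rootOneSubLam x ^ 8 * (1 - 2 * x ^ p) ^ 8)
      (by fun_prop)
  · filter_upwards [eventually_im_pos] with τ hτ
    exact (H.powY τ hτ).symm
  · refine Eventually.of_forall fun τ => ?_
    simp only [← mul_pow, ← pow_mul, Nat.mul_comm 8 n]

end Pair

/-! ### The coefficients of a cubic relation between `X` and `Y` -/

/-- The entries `a_{i,h}` of `A` with `i + h ≤ 3`, other than `a_{0,0}` and `a_{3,0}`, are the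
coefficients of `(1 - X - Y)³ - c X Y`. -/
def IsCubic (A : Matrix (Fin 4) (Fin 4) ℤ) (c : ℤ) : Prop :=
  (A 0 1 = -3 ∧ A 0 2 = 3 ∧ A 0 3 = -1) ∧
    (A 1 0 = -3 ∧ A 1 1 = 6 - c ∧ A 1 2 = -3) ∧ A 2 0 = 3 ∧ A 2 1 = -3

/-- With `X ~ u q³` and `1 - Y ~ v q`, the functions `1, 1 - Y, (1 - Y)²` have exact orders
`0, 1, 2` in `q`, which determines the row `i = 0` up to normalization; after that
`X, X (1 - Y), X (1 - Y)², X², X² (1 - Y)` have exact orders `3, …, 7`, so that every relation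
modulo `q^8` fixes the further entries. -/
theorem IsRussellMatrix.isCubic_of_eqMod {X Y : ℂ → ℂ} {A : Matrix (Fin 4) (Fin 4) ℤ}
    (hA : IsRussellMatrix 3 X Y A) {u v : ℂ} (hu : u ≠ 0) (hv : v ≠ 0)
    (hX : Tendsto (fun τ => X τ / nome τ ^ 3) imInfty (𝓝 u))
    (hY : Tendsto (fun τ => (1 - Y τ) / nome τ) imInfty (𝓝 v)) {c : ℤ}
    (H : EqMod 8 (fun τ => (1 - X τ - Y τ) ^ 3 - c * X τ * Y τ) fun _ => 0) :
    IsCubic A c := by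
  set U : ℂ → ℂ := fun τ => X τ / nome τ ^ 3 with hUdef
  set V : ℂ → ℂ := fun τ => (1 - Y τ) / nome τ with hVdef
  have hXU : ∀ τ, X τ = nome τ ^ 3 * U τ := fun τ =>
    (mul_div_cancel₀ _ (pow_ne_zero 3 (nome_ne_zero τ))).symm
  have hYV : ∀ τ, Y τ = 1 - nome τ * V τ := fun τ => by
    rw [hVdef, mul_div_cancel₀ _ (nome_ne_zero τ), sub_sub_cancel]
  have hbdd : ∀ F : ℂ × ℂ × ℂ → ℂ, Continuous F →
      (fun τ => F (nome τ, U τ, V τ)) =O[imInfty] fun _ => (1 : ℂ) := fun F hF =>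
    ((hF.tendsto (0, u, v)).comp
      (tendsto_nome.prodMk_nhds (hX.prodMk_nhds hY))).isBigO_one ℂ
  have hzero : ∀ (N : ℕ) (f : ℂ → ℂ) (F : ℂ × ℂ × ℂ → ℂ), Continuous F →
      (∀ᶠ τ in imInfty, f τ = nome τ ^ N * F (nome τ, U τ, V τ)) → EqMod N f fun _ => 0 := by
    intro N f F hF hf
    refine ((isBigO_refl (fun τ => nome τ ^ N) imInfty).mul (hbdd F hF)).congr' ?_
      (Eventually.of_forall fun τ => mul_one _)
    filter_upwards [hf] with τ hτ
    rw [hτ, sub_zero]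
  have hrel : ∀ τ : ℂ, 0 < τ.im →
      1 + A 0 1 * Y τ + A 0 2 * Y τ ^ 2 + A 0 3 * Y τ ^ 3
        + (A 1 0 + A 1 1 * Y τ + A 1 2 * Y τ ^ 2) * X τ
        + (A 2 0 + A 2 1 * Y τ) * X τ ^ 2 + A 3 0 * X τ ^ 3 = 0 := by
    intro τ hτ
    have h := hA.vanishes τ hτ
    have h00 : A 0 0 = 1 := hA.normalized
    have h13 : A 1 3 = 0 := hA.triangular 1 3 (by decide)
    have h22 : A 2 2 = 0 := hA.triangular 2 2 (by decide)
    have h23 : A 2 3 = 0 := hA.triangular 2 3 (by decide)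
    have h31 : A 3 1 = 0 := hA.triangular 3 1 (by decide)
    have h32 : A 3 2 = 0 := hA.triangular 3 2 (by decide)
    have h33 : A 3 3 = 0 := hA.triangular 3 3 (by decide)
    simp [Fin.sum_univ_four, h00, h13, h22, h23, h31, h32, h33] at h
    linear_combination h
  have hrow0 : A 0 1 = -3 ∧ A 0 2 = 3 ∧ A 0 3 = -1 := by
    -- The coefficients of `∑ a_{0,h} Yʰ` as a polynomial in `1 - Y = q V`; the cubic term joins the
    -- terms with `X`, which is divisible by `q³`.
    have key := eq_zero_of_eqMod_sum (N := 3) (w := fun j => v ^ j)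
      (W := fun j τ => V τ ^ j)
      (c := fun j => [(1 + A 0 1 + A 0 2 + A 0 3 : ℂ), -(A 0 1 + 2 * A 0 2 + 3 * A 0 3),
        A 0 2 + 3 * A 0 3].getD j 0)
      (fun j _ => pow_ne_zero j hv) (fun j _ => hY.pow j) (hzero 3 _ (fun z =>
        A 0 3 * z.2.2 ^ 3 - (A 1 0 + A 1 1 * (1 - z.1 * z.2.2)
          + A 1 2 * (1 - z.1 * z.2.2) ^ 2) * z.2.1
        - (A 2 0 + A 2 1 * (1 - z.1 * z.2.2)) * (z.1 ^ 3 * z.2.1 ^ 2)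
        - A 3 0 * (z.1 ^ 6 * z.2.1 ^ 3)) (by fun_prop) ?_)
    · have h0 := key 0 (by norm_num)
      have h1 := key 1 (by norm_num)
      have h2 := key 2 (by norm_num)
      simp only [List.getD_cons_zero, List.getD_cons_succ] at h0 h1 h2
      norm_cast at h0 h1 h2
      omega
    · filter_upwards [eventually_im_pos] with τ hτ
      have h := hrel τ hτ
      rw [hXU, hYV] at h
      simp [Finset.sum_range_succ]
      linear_combination h
  obtain ⟨h01, h02, h03⟩ := hrow0
  refine ⟨⟨h01, h02, h03⟩, ?_⟩
  -- The coefficients of the given relation minus `(1 - X - Y)³ - c X Y`, after `Y = 1 - q V`. The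
  -- entries below index `3` vanish by what is known about the row `i = 0`.
  have key := eq_zero_of_eqMod_sum (N := 8)
    (w := fun j => [1, 1, 1, u, u * v, u * v ^ 2, u ^ 2, u ^ 2 * v].getD j 1)
    (W := fun j τ => [1, 1, 1, U τ, U τ * V τ, U τ * V τ ^ 2, U τ ^ 2, U τ ^ 2 * V τ].getD j 1)
    (c := fun j => [0, 0, 0, (A 1 0 + A 1 1 + A 1 2 + c : ℂ), -(A 1 1 + 2 * A 1 2) - c,
      A 1 2 + 3, A 2 0 + A 2 1, -A 2 1 - 3].getD j 0) ?_ ?_ ?_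
  · have h3 := key 3 (by norm_num)
    have h4 := key 4 (by norm_num)
    have h5 := key 5 (by norm_num)
    have h6 := key 6 (by norm_num)
    have h7 := key 7 (by norm_num)
    simp only [List.getD_cons_zero, List.getD_cons_succ] at h3 h4 h5 h6 h7
    norm_cast at h3 h4 h5 h6 h7
    omega
  · intro j hj
    interval_cases j <;> simp [hu, hv]
  · intro j hj
    interval_cases j
    · exact tendsto_const_nhds
    · exact tendsto_const_nhds
    · exact tendsto_const_nhds
    · exact hX
    · exact hX.mul hY
    · exact hX.mul (hY.pow 2)
    · exact hX.pow 2
    · exact (hX.pow 2).mul hY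
  -- The relation leaves `a_{3,0}` free, but `X³` has order `9`.
  · have hcube : EqMod 8 (fun τ => (A 3 0 + 1) * X τ ^ 3) fun _ => 0 :=
      hzero 8 _ (fun z => (A 3 0 + 1) * (z.1 * z.2.1 ^ 3)) (by fun_prop)
        (Eventually.of_forall fun τ => by simp only [hXU]; ring)
    refine ((EqMod.refl 8 fun _ => 0).sub (H.add hcube)).congr' ?_
      (Eventually.of_forall fun τ => by simp)
    filter_upwards [eventually_im_pos] with τ hτ
    have h := hrel τ hτ
    rw [h01, h02, h03, hXU, hYV] at h
    simp [Finset.sum_range_succ, hXU, hYV]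
    push_cast at h
    linear_combination -h

/-! ### The modular equations of degrees 5, 11 and 23 to eighth order -/

/-- If `X = q³ U` and `Y = 1 - q V` with `U ≡ P(q)` and `V ≡ Q(q)` modulo `q^5`, then
`(1 - X - Y)³ - c X Y = q³ ((V - q² U)³ - c U (1 - q V))`, so that the polynomial identity `hPQ`
yields a relation modulo `q^8`. -/
theorem eqMod_cubic {X Y : ℂ → ℂ} {P Q R : ℂ → ℂ} (hP : Continuous P) (hQ : Continuous Q)
    (hR : Continuous R) {c : ℤ} (hX : EqMod 5 (fun τ => X τ / nome τ ^ 3) fun τ => P (nome τ))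
    (hY : EqMod 6 Y fun τ => 1 - nome τ * Q (nome τ))
    (hPQ : ∀ x, (Q x - x ^ 2 * P x) ^ 3 - c * P x * (1 - x * Q x) = x ^ 5 * R x) :
    EqMod 5 (fun τ => (1 - Y τ) / nome τ) (fun τ => Q (nome τ)) ∧
      EqMod 8 (fun τ => (1 - X τ - Y τ) ^ 3 - c * X τ * Y τ) fun _ => 0 := by
  have hV : EqMod 5 (fun τ => (1 - Y τ) / nome τ) fun τ => Q (nome τ) := by
    refine EqMod.of_nome_mul (((EqMod.refl 6 fun _ => 1).sub hY).congr' ?_ ?_)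
    · exact Eventually.of_forall fun τ => (mul_div_cancel₀ _ (nome_ne_zero τ)).symm
    · exact Eventually.of_forall fun τ => sub_sub_cancel _ _
  refine ⟨hV, ?_⟩
  have hPb := isBigO_one_comp_nome hP
  have hQ' : EqMod 5 Y fun τ => 1 - nome τ * Q (nome τ) := hY.mono (by norm_num)
  have hq : (fun τ => nome τ ^ 2) =O[imInfty] fun _ => (1 : ℂ) :=
    isBigO_one_comp_nome (continuous_pow 2)
  have h1 := (hV.sub ((EqMod.refl 5 fun τ => nome τ ^ 2).mul hX hq hPb)).pow
    (isBigO_one_comp_nome (P := fun x => Q x - x ^ 2 * P x) (by fun_prop)) 3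
  have h2 := (hX.const_mul (c : ℂ)).mul hQ'
    (isBigO_one_comp_nome (P := fun x => c * P x) (by fun_prop))
    (isBigO_one_comp_nome (P := fun x => 1 - x * Q x) (by fun_prop))
  have h3 : EqMod 5 (fun τ => (Q (nome τ) - nome τ ^ 2 * P (nome τ)) ^ 3
      - c * P (nome τ) * (1 - nome τ * Q (nome τ))) fun _ => 0 :=
    EqMod.of_eq_pow_mul (P := fun x => (Q x - x ^ 2 * P x) ^ 3 - c * P x * (1 - x * Q x))
      (Q := fun _ => 0) R hR fun x => by rw [sub_zero, hPQ]
  refine (((h1.sub h2).trans h3).nome_pow_mul 3).congr' ?_ ?_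
  · refine Eventually.of_forall fun τ => ?_
    have := nome_ne_zero τ
    field_simp
    ring
  · exact Eventually.of_forall fun τ => mul_zero _

section Cases

variable {X Y : ℂ → ℂ} {A : Matrix (Fin 4) (Fin 4) ℤ}

theorem isCubic_of_expansions {P Q R : ℂ → ℂ} (hP : Continuous P) (hQ : Continuous Q)
    (hR : Continuous R) (hP0 : P 0 ≠ 0) (hQ0 : Q 0 ≠ 0) {c : ℤ}
    (hA : IsRussellMatrix 3 X Y A)
    (hX : EqMod 5 (fun τ => X τ / nome τ ^ 3) fun τ => P (nome τ))
    (hY : EqMod 6 Y fun τ => 1 - nome τ * Q (nome τ))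
    (hPQ : ∀ x, (Q x - x ^ 2 * P x) ^ 3 - c * P x * (1 - x * Q x) = x ^ 5 * R x) :
    IsCubic A c := by
  obtain ⟨hV, H⟩ := eqMod_cubic hP hQ hR hX hY hPQ
  exact hA.isCubic_of_eqMod hP0 hQ0 (hX.tendsto (by norm_num) (tendsto_comp_nome hP))
    (hV.tendsto (by norm_num) (tendsto_comp_nome hQ)) H

/-- Here `P` and `Q` are the truncated expansions of `X / q³` and `(1 - Y) / q`, and `R` as well as
the last function in each use of `EqMod.of_eq_pow_mul` are quotients of exact polynomial
divisions by the relevant power of `x`; likewise in the two other degrees. -/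
theorem isCubic_five (H : IsRussellPair 5 3 4 X Y) (hA : IsRussellMatrix 3 X Y A) :
    IsCubic A 32 := by
  refine isCubic_of_expansions
    (P := fun x => 16 - 64 * x + 224 * x ^ 2 - 640 * x ^ 3 + 1616 * x ^ 4)
    (Q := fun x => 8 - 32 * x + 96 * x ^ 2 - 256 * x ^ 3 + 632 * x ^ 4)
    (R := fun x => 159744 - 877568 * x + 4390912 * x ^ 2 - 17363456 * x ^ 3 + 60151808 * x ^ 4
      - 136461312 * x ^ 5 + 286789632 * x ^ 6 - 368534016 * x ^ 7 + 96092160 * x ^ 8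
      + 1512526848 * x ^ 9 - 3773874176 * x ^ 10 + 1210681344 * x ^ 11 + 5013995520 * x ^ 12
      - 4220112896 * x ^ 13)
    (by fun_prop) (by fun_prop) (by fun_prop) (by norm_num) (by norm_num) hA
    ((H.X_div_eqMod (by norm_num) (by norm_num)).trans ?_)
    ((H.Y_eqMod (by norm_num)).trans ?_) fun x => by push_cast; ring
  · exact EqMod.of_eq_pow_mul (P := fun x => 2 ^ 4 * rootLam x ^ 4)
      (Q := fun x => 16 - 64 * x + 224 * x ^ 2 - 640 * x ^ 3 + 1616 * x ^ 4)
      (fun x => -3392 + 6560 * x - 11328 * x ^ 2 + 17632 * x ^ 3 - 24384 * x ^ 4 + 31040 * x ^ 5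
        - 34944 * x ^ 6 + 34576 * x ^ 7 - 29440 * x ^ 8 + 22016 * x ^ 9 - 12288 * x ^ 10
        + 4096 * x ^ 11)
      (by fun_prop) fun x => by simp only [rootLam]; ring
  · exact EqMod.of_eq_pow_mul (P := fun x => (rootOneSubLam x * (1 - 2 * x ^ 5)) ^ 4)
      (Q := fun x => 1 - x * (8 - 32 * x + 96 * x ^ 2 - 256 * x ^ 3 + 632 * x ^ 4))
      (fun x => (1360 - 2656 * x + 4808 * x ^ 2 - 8160 * x ^ 3 + 12800 * x ^ 4 - 18432 * x ^ 5
        + 24640 * x ^ 6 - 30912 * x ^ 7 + 35648 * x ^ 8 - 36992 * x ^ 9 + 34576 * x ^ 10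
        - 29440 * x ^ 11 + 22016 * x ^ 12 - 12288 * x ^ 13 + 4096 * x ^ 14) * (1 - 2 * x ^ 5) ^ 4
        + (1 - 8 * x + 32 * x ^ 2 - 96 * x ^ 3 + 256 * x ^ 4 - 624 * x ^ 5) * x ^ 4
          * (24 - 32 * x ^ 5 + 16 * x ^ 10)
        + (64 - 256 * x + 768 * x ^ 2 - 2048 * x ^ 3 + 4992 * x ^ 4))
      (by fun_prop) fun x => by simp only [rootOneSubLam]; ring

theorem isCubic_eleven (H : IsRussellPair 11 3 2 X Y) (hA : IsRussellMatrix 3 X Y A) :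
    IsCubic A 16 := by
  refine isCubic_of_expansions
    (P := fun x => 4 - 8 * x + 20 * x ^ 2 - 40 * x ^ 3 + 72 * x ^ 4)
    (Q := fun x => 4 - 8 * x + 16 * x ^ 2 - 32 * x ^ 3 + 56 * x ^ 4)
    (R := fun x => 2560 - 8256 * x + 24192 * x ^ 2 - 60032 * x ^ 3 + 138240 * x ^ 4
      - 186432 * x ^ 5 + 220800 * x ^ 6 - 213696 * x ^ 7 + 81792 * x ^ 8 + 494208 * x ^ 9
      - 931328 * x ^ 10 + 214272 * x ^ 11 + 622080 * x ^ 12 - 373248 * x ^ 13)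
    (by fun_prop) (by fun_prop) (by fun_prop) (by norm_num) (by norm_num) hA
    ((H.X_div_eqMod (by norm_num) (by norm_num)).trans ?_)
    ((H.Y_eqMod (by norm_num)).trans ?_) fun x => by push_cast; ring
  · exact EqMod.of_eq_pow_mul (P := fun x => 2 ^ 2 * rootLam x ^ 2)
      (Q := fun x => 4 - 8 * x + 20 * x ^ 2 - 40 * x ^ 3 + 72 * x ^ 4)
      (fun x => -80 + 100 * x - 96 * x ^ 2 + 64 * x ^ 3)
      (by fun_prop) fun x => by simp only [rootLam]; ring
  · have hc := continuous_rootOneSubLam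
    exact EqMod.of_eq_pow_mul (P := fun x => (rootOneSubLam x * (1 - 2 * x ^ 11)) ^ 2)
      (Q := fun x => 1 - x * (4 - 8 * x + 16 * x ^ 2 - 32 * x ^ 3 + 56 * x ^ 4))
      (fun x => 72 - 80 * x + 100 * x ^ 2 - 96 * x ^ 3 + 64 * x ^ 4
        + rootOneSubLam x ^ 2 * (-4 * x ^ 5 + 4 * x ^ 16))
      (by fun_prop) fun x => by simp only [rootOneSubLam]; ring

theorem isCubic_twentyThree (H : IsRussellPair 23 3 1 X Y) (hA : IsRussellMatrix 3 X Y A) :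
    IsCubic A 4 := by
  refine isCubic_of_expansions
    (P := fun x => 2 - 2 * x + 4 * x ^ 2 - 6 * x ^ 3 + 8 * x ^ 4)
    (Q := fun x => 2 - 2 * x + 4 * x ^ 2 - 6 * x ^ 3 + 8 * x ^ 4)
    (R := fun x => 96 - 216 * x + 376 * x ^ 2 - 672 * x ^ 3 + 1128 * x ^ 4 - 936 * x ^ 5
      + 360 * x ^ 6 - 104 * x ^ 7 - 336 * x ^ 8 + 1584 * x ^ 9 - 1704 * x ^ 10 - 96 * x ^ 11
      + 1152 * x ^ 12 - 512 * x ^ 13)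
    (by fun_prop) (by fun_prop) (by fun_prop) (by norm_num) (by norm_num) hA
    ((H.X_div_eqMod (by norm_num) (by norm_num)).trans ?_)
    ((H.Y_eqMod (by norm_num)).trans ?_) fun x => by push_cast; ring
  · exact EqMod.of_eq_pow_mul (P := fun x => 2 ^ 1 * rootLam x ^ 1)
      (Q := fun x => 2 - 2 * x + 4 * x ^ 2 - 6 * x ^ 3 + 8 * x ^ 4)
      (fun _ => 0) (by fun_prop) fun x => by simp only [rootLam]; ring
  · have hc := continuous_rootOneSubLam
    exact EqMod.of_eq_pow_mul (P := fun x => (rootOneSubLam x * (1 - 2 * x ^ 23)) ^ 1)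
      (Q := fun x => 1 - x * (2 - 2 * x + 4 * x ^ 2 - 6 * x ^ 3 + 8 * x ^ 4))
      (fun x => rootOneSubLam x * (-2 * x ^ 17))
      (by fun_prop) fun x => by simp only [rootOneSubLam]; ring

end Cases

/-! ### Evaluation of the closed forms -/

theorem IsCubic.entry {A : Matrix (Fin 4) (Fin 4) ℤ} {c : ℤ} (h : IsCubic A c) :
    (((A 0 1 : ℚ) = -3 ∧ (A 0 2 : ℚ) = 3 ∧ (A 0 3 : ℚ) = -1) ∧
      ((A 1 0 : ℚ) = -3 ∧ (A 1 1 : ℚ) = 6 - c ∧ (A 1 2 : ℚ) = -3) ∧ (A 2 0 : ℚ) = 3) := by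
  obtain ⟨⟨h1, h2, h3⟩, ⟨h4, h5, h6⟩, h7, -⟩ := h
  rw [h1, h2, h3, h4, h5, h6, h7]
  push_cast
  simp

/-- The row `i = 0` of `A` is `(1, -3, 3, -1)`, so that `A^{1,0} a₀` consists of third differences of
`b_{l+3}(2h, 0)` in `h`. -/
theorem blockTimesRowZero_of_isCubic {p n : ℕ} {A : Matrix (Fin 4) (Fin 4) ℤ} {c : ℤ}
    (h00 : A 0 0 = 1) (h : IsCubic A c) (l : Fin 3) :
    blockTimesRowZero p 3 n A l =
      b p n (l + 3) 0 0 - 3 * b p n (l + 3) 2 0 + 3 * b p n (l + 3) 4 0 - b p n (l + 3) 6 0 := by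
  obtain ⟨⟨h1, h2, h3⟩, -⟩ := h.entry
  have h0 : (A 0 0 : ℚ) = 1 := by rw [h00, Int.cast_one]
  rw [blockTimesRowZero, Matrix.mulVec, dotProduct, Fin.sum_univ_four]
  dsimp only [block, Matrix.of_apply]
  rw [h0, h1, h2, h3]
  norm_num
  ring

theorem det_threeByThree (a₁ a₂ a₃ b₁ b₂ b₃ c₁ c₂ c₃ : ℚ) :
    Matrix.det !![a₁, a₂, a₃; b₁, b₂, b₃; c₁, c₂, c₃] =
      a₁ * (b₂ * c₃ - b₃ * c₂) - a₂ * (b₁ * c₃ - b₃ * c₁) + a₃ * (b₁ * c₂ - b₂ * c₁) := by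
  rw [Matrix.det_fin_three]
  simp
  ring

end Russell

theorem mainTheorem2 (p m n : ℕ)
    (hpn : (p = 5 ∧ n = 4) ∨ (p = 11 ∧ n = 2) ∨ (p = 23 ∧ n = 1)) (hm : m = 3)
    (X Y : ℂ → ℂ) (hXY : Russell.IsRussellPair p m n X Y)
    (A : Matrix (Fin (m + 1)) (Fin (m + 1)) ℤ) (hA : Russell.IsRussellMatrix m X Y A) :
    -- first row
    ((A 1 0 : ℚ) = -((2 : ℚ) ^ ((m : ℤ) - n - 3) * (n : ℚ) ^ ((m : ℤ) - 2) *
        (2 * n * Russell.alpha p 2 + 2 * m * Russell.alpha p 3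
          + (n : ℚ) ^ 2 * (15 - 16 * Russell.P 1 m + 8 * Russell.P 2 m))) ∧
      (A 1 1 : ℚ) = -((2 : ℚ) ^ ((m : ℤ) - n - 3) * (n : ℚ) ^ ((m : ℤ) - 2) *
        (-4 * n * Russell.alpha p 2 - 4 * m * Russell.alpha p 3
          - 2 * (n : ℚ) ^ 2 * (5 - 12 * Russell.P 1 m + 8 * Russell.P 2 m))) ∧
      (A 1 2 : ℚ) = -((2 : ℚ) ^ ((m : ℤ) - n - 3) * (n : ℚ) ^ ((m : ℤ) - 2) *
        (2 * n * Russell.alpha p 2 + 2 * m * Russell.alpha p 3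
          + (n : ℚ) ^ 2 * (3 - 8 * Russell.P 1 m + 8 * Russell.P 2 m)))) ∧
    -- second row
    ((A 2 0 : ℚ) = 1 / (2 * n) *
        (1 / 3 * (n : ℚ) ^ m * (2 : ℚ) ^ ((m : ℤ) - 2 * n - 3) *
          ((464 * Russell.P 2 m - 384 * Russell.P 1 m + 135) * (n : ℚ) ^ 4
            - 4 * (24 * Russell.P 2 m - 29) * (n : ℚ) ^ 3 * Russell.alpha p 2
            + (n : ℚ) ^ 2 * (-12 * Russell.alpha p 2 ^ 2
                + 4 * (48 * Russell.P 2 m + 29 * m) * Russell.alpha p 3)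
            + n * (-24 * ((m : ℚ) - 2) * Russell.alpha p 6 - 24 * Russell.alpha p 4)
            + 48 * m * Russell.alpha p 3 ^ 2)
        - (2 : ℚ) ^ (2 * (m : ℤ) - 2 * n + 1) * (n : ℚ) ^ (2 * m + 1) * Russell.P 4 m
        - (n : ℚ) ^ (2 * (m : ℤ) - 1) * (2 : ℚ) ^ (2 * (m : ℤ) - 2 * n - 1) * Russell.P 2 m
            * (2 * (m : ℚ) - 1) * Russell.alpha p 3
        - (n : ℚ) ^ (2 * (m : ℤ) - 3) * (2 : ℚ) ^ (2 * (m : ℤ) - 2 * n - 3) *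
            ((2 * (m : ℚ) - 3) * (2 * (m : ℚ) - 4) * (Russell.alpha p 3 ^ 2 / 2)
              + (2 * (m : ℚ) - 3) * Russell.alpha p 5)) ∧
      A 2 1 = -A 2 0) ∧
    -- the determinant
    Matrix.det !![Russell.b p n 0 3 1, Russell.b p n 0 5 1, Russell.blockTimesRowZero p m n A 0;
                  Russell.b p n 1 3 1, Russell.b p n 1 5 1, Russell.blockTimesRowZero p m n A 1;
                  Russell.b p n 2 3 1, Russell.b p n 2 5 1, Russell.blockTimesRowZero p m n A 2]
      = (m : ℚ) * (-2 * (n : ℚ)) ^ 3 * 2 ^ n := by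
  subst hm
  have h00 : A 0 0 = 1 := hA.normalized
  -- Among the values `α_p(k)` with `k ≤ 6` only `α_p(5)` depends on `p`, through the divisor `p = 5`.
  obtain ⟨c, r, hp, h, a5, a6, hncr⟩ : ∃ (c : ℤ) (r : ℚ), 4 < p ∧ Russell.IsCubic A c ∧
      Russell.alpha p 5 = r ∧ Russell.alpha p 6 = -2 ∧
      ((n = 4 ∧ c = 32 ∧ r = 11 / 5) ∨ (n = 2 ∧ c = 16 ∧ r = 6 / 5) ∨
        (n = 1 ∧ c = 4 ∧ r = 6 / 5)) := by
    rcases hpn with ⟨rfl, rfl⟩ | ⟨rfl, rfl⟩ | ⟨rfl, rfl⟩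
    · exact ⟨32, 11 / 5, by norm_num, Russell.isCubic_five hXY hA, Russell.alpha_five_five,
        Russell.alpha_five_six, by simp⟩
    · exact ⟨16, 6 / 5, by norm_num, Russell.isCubic_eleven hXY hA,
        Russell.alpha_five (by norm_num), Russell.alpha_six (by norm_num), by simp⟩
    · exact ⟨4, 6 / 5, by norm_num, Russell.isCubic_twentyThree hXY hA,
        Russell.alpha_five (by norm_num), Russell.alpha_six (by norm_num), by simp⟩
  have h21 : A 2 1 = -A 2 0 := by rw [h.2.2.1, h.2.2.2]
  obtain ⟨-, ⟨h10, h11, h12⟩, h20⟩ := h.entry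
  have hb := Russell.blockTimesRowZero_of_isCubic (p := p) (n := n) h00 h
  have e0 : ((0 : Fin 3) : ℕ) + 3 = 3 := rfl
  have e1 : ((1 : Fin 3) : ℕ) + 3 = 4 := rfl
  have e2 : ((2 : Fin 3) : ℕ) + 3 = 5 := rfl
  rw [h10, h11, h12, h20, hb 0, hb 1, hb 2, e0, e1, e2, Russell.det_threeByThree]
  simp only [Russell.alpha_one (show 1 < p by omega), Russell.alpha_two (show 2 < p by omega),
    Russell.alpha_three (show 3 < p by omega), Russell.alpha_four hp, a5, a6,
    Russell.P_one_three, Russell.P_two_three, Russell.P_four_three, Russell.b_zero,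
    Russell.b_one, Russell.b_two, Russell.b_three, Russell.b_four, Russell.b_five]
  rcases hncr with ⟨rfl, rfl, rfl⟩ | ⟨rfl, rfl, rfl⟩ | ⟨rfl, rfl, rfl⟩ <;>
    refine ⟨⟨?_, ?_, ?_⟩, ⟨?_, h21⟩, ?_⟩ <;> norm_num
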